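/- Let $\mathcal H$ be a real Hilbert space. Let $\mathcal P(\mathcal H)$ be the set of bounded linear self-adjoint operators $P$ on $\mathcal H$ that are positive definite, in the sense that $\langle x,Px\rangle\ge\lambda\|x\|^2$ for all $x\in\mathcal H$ and some $\lambda>0$, and write $\|x\|_P=\sqrt{\langle x,Px\rangle}$. For $A:\mathcal H\to2^{\mathcal H}$ and $C:\mathcal H\to\mathcal H$ write $\mathrm{zer}(A+C)=\{x: 0\in Ax+Cx\}$. Let $P,S\in\mathcal P(\mathcal H)$ and assume the following. - $A:\mathcal H\to 2^{\mathcal H}$ is maximally monotone. - $C:\mathcal H\to\mathcal H$ is $\tfrac1\beta$-cocoercive w.r.t. $\|\cdot\|_P$ with $\beta\in[0,4)$, that is, $\|Cx-Cy\|_{P^{-1}}^2\le\beta\langle Cx-Cy,x-y\rangle$ for all $x,y\in\mathcal H$ (for $\beta=0$: $C$ is constant). - $\mathrm{zer}(A+C)\neq\emptyset$. - The kernels $M_k:\mathcal H\to\mathcal H$, $k\in\mathbb N=\{0,1,2,\dots\}$, are single-valued and $1$-strongly monotone w.r.t. $\|\cdot\|_P$, that is, $\langle M_kx-M_ky,x-y\rangle\ge\|x-y\|_P^2$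 for all $x,y\in\mathcal H$, and they are Lipschitz continuous w.r.t. $\|\cdot\|$ with a common constant $L_M$ independent of $k$. - The relaxation parameters satisfy $\theta_k\in(0,2)$ for all $k$ and $\liminf_{k\to\infty}\theta_k(2-\theta_k)>0$. Consider the algorithm NOFOB: given $x_0\in\mathcal H$, for $k=0,1,2,\dots$ let $$\hat x_k:=(M_k+A)^{-1}(M_k-C)x_k,$$ $$H_k:=\{z\in\mathcal H:\langle M_kx_k-M_k\hat x_k,z-\hat x_k\rangle\le\tfrac\beta4\|x_k-\hat x_k\|_P^2\},$$ $$x_{k+1}:=(1-\theta_k)x_k+\theta_k\Pi^S_{H_k}(x_k),$$ where $\Pi^S_{H_k}(x)=\operatorname{argmin}_{y\in H_k}\|x-y\|_S$. Then, for every $x_0\in\mathcal H$, the algorithm is well defined: it constructs exactly one pair of infinite sequences $(x_k)_{k\in\mathbb N}$ and $(\hat x_k)_{k\in\mathbb N}$. These sequences satisfy: 1. $(x_k)$ is Fejér monotone w.r.t. $\mathrm{zer}(A+C)$ in $\|\cdot\|_S$, that is, $\|x_{k+1}-z\|_S\le\|x_k-z\|_S$ for all $k\in\mathbb N$ and $z\in\mathrm{zer}(A+C)$;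 and $(\|x_k-z\|_S)_{k\in\mathbb N}$ converges for every $z\in\mathrm{zer}(A+C)$; 2. $\|x_k-\hat x_k\|_S\to0$; 3. $(x_k)$ converges weakly to a point of $\mathrm{zer}(A+C)$. -/

import Mathlib

open Filter Topology
open scoped Pointwise

namespace NOFOB

variable {H : Type*} [NormedAddCommGroup H] [InnerProductSpace ℝ H]

/-- The class of bounded linear self-adjoint positive definite operators on `H`. Positive
definiteness is meant with a positive lower bound (`lam` plays the role of the smallest spectral
value), so that such an operator has a bounded inverse. -/
structure IsPosDef [CompleteSpace H] (P : H →L[ℝ] H) : Prop where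
  selfAdjoint : IsSelfAdjoint P
  lower : ∃ lam : ℝ, 0 < lam ∧ ∀ x : H, lam * ‖x‖ ^ 2 ≤ inner ℝ x (P x)

/-- The scaled norm `‖x‖_P = √⟨x, P x⟩`. -/
noncomputable def pnorm (P : H →L[ℝ] H) (x : H) : ℝ :=
  Real.sqrt (inner ℝ x (P x))

/-- An operator in `IsPosDef` is invertible, so that `P.inverse` is its true inverse. -/
theorem IsPosDef.isInvertible [CompleteSpace H] {P : H →L[ℝ] H} (hP : IsPosDef P) :
    P.IsInvertible := by
  obtain ⟨lam, hlam, h⟩ := hP.lower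
  have hc : IsCoercive ((innerSL ℝ).comp P : H →L[ℝ] H →L[ℝ] ℝ) := by
    refine ⟨lam, hlam, fun u => ?_⟩
    have h1 := h u
    rw [real_inner_comm] at h1
    simpa [pow_two, mul_assoc] using h1
  refine ⟨hc.continuousLinearEquivOfBilin, ?_⟩
  ext v
  refine ext_inner_right ℝ fun w => ?_
  have h2 := hc.continuousLinearEquivOfBilin_apply v w
  simp [h2]

/-- A single-valued operator seen as a set-valued one. -/
def single (T : H → H) : H → Set H := fun x => {T x}

/-- The inverse of a set-valued operator. -/
def inv (A : H → Set H) : H → Set H := fun u => {x | u ∈ A x}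

/-- The set of zeros of a set-valued operator. -/
def zer (A : H → Set H) : Set H := {x | (0 : H) ∈ A x}

/-- Monotonicity of a set-valued operator. -/
def IsMonotone (A : H → Set H) : Prop :=
  ∀ ⦃x u y v : H⦄, u ∈ A x → v ∈ A y → 0 ≤ inner ℝ (u - v) (x - y)

/-- Maximal monotonicity: monotone, and no monotone operator has a strictly larger graph. -/
def IsMaximallyMonotone (A : H → Set H) : Prop :=
  IsMonotone A ∧ ∀ B : H → Set H, IsMonotone B → (∀ x, A x ⊆ B x) → B = A

/-- `σ`-strong monotonicity with respect to `‖·‖_P`. -/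
def IsStronglyMonotone (σ : ℝ) (P : H →L[ℝ] H) (A : H → Set H) : Prop :=
  0 < σ ∧ ∀ ⦃x u y v : H⦄, u ∈ A x → v ∈ A y →
    σ * pnorm P (x - y) ^ 2 ≤ inner ℝ (u - v) (x - y)

/-- `1/β`-cocoercivity with respect to `‖·‖_P`, for `β ≥ 0`:
`⟨T x - T y, x - y⟩ ≥ (1/β) ‖T x - T y‖²` in the norm of `P⁻¹`, multiplied by `β`. For `β = 0`
(that is, `1/β = ∞`) it says that `T` is constant. -/
def IsInvCocoercive (β : ℝ) (P : H →L[ℝ] H) (T : H → H) : Prop :=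
  0 ≤ β ∧ ∀ x y : H,
    pnorm P.inverse (T x - T y) ^ 2 ≤ β * inner ℝ (T x - T y) (x - y)

/-- The nonlinear forward-backward map `(M + A)⁻¹ ∘ (M - C)`, a priori set-valued. -/
def fbMap (A : H → Set H) (C M : H → H) (x : H) : Set H :=
  inv (single M + A) (M x - C x)

/-- The halfspace built from the current point `x` and its forward-backward image `xh`. -/
def halfspace (β : ℝ) (P : H →L[ℝ] H) (M : H → H) (x xh : H) : Set H :=
  {z | inner ℝ (M x - M xh) (z - xh) ≤ β / 4 * pnorm P (x - xh) ^ 2}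

/-- The projection onto `D` in the metric `‖·‖_S`: the set of minimizers of `‖x - ·‖_S` over
`D`. -/
def proj (S : H →L[ℝ] H) (D : Set H) (x : H) : Set H :=
  {p | p ∈ D ∧ ∀ z ∈ D, pnorm S (x - p) ≤ pnorm S (x - z)}

/-- `x` and `xh` are the sequences of iterates of the nonlinear forward-backward splitting
algorithm with kernels `M k`, relaxation parameters `θ k` and projection metric `‖·‖_S`. -/
structure IsRun (A : H → Set H) (C : H → H) (β : ℝ) (P S : H →L[ℝ] H) (M : ℕ → H → H)
    (θ : ℕ → ℝ) (x xh : ℕ → H) : Prop where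
  forwardBackward : ∀ k, xh k ∈ fbMap A C (M k) (x k)
  relaxedProjection : ∀ k, ∃ p ∈ proj S (halfspace β P (M k) (x k) (xh k)) (x k),
    x (k + 1) = (1 - θ k) • x k + θ k • p

/-- Fejér monotonicity of a sequence with respect to a set, in the norm `‖·‖_S`. -/
def IsFejerMonotone (S : H →L[ℝ] H) (D : Set H) (x : ℕ → H) : Prop :=
  ∀ z ∈ D, ∀ k, pnorm S (x (k + 1) - z) ≤ pnorm S (x k - z)

end NOFOB

/-!
The proof rests on two facts.

*Surjectivity.* If `A` is maximally monotone and `T` is Lipschitz continuous and strongly monotone,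
then `A + T` is onto (`IsMaximallyMonotone.exists_sub_mem`). For `T = Id` this is Minty's theorem
(`exists_neg_mem`), obtained by minimizing the Fitzpatrick function of `A` plus half the squared
norm over `H × H`; the general case follows by applying Banach's fixed point theorem to a
forward-backward step. With `T = M k` it makes the forward-backward map single-valued with full
domain, hence, together with the explicit projection onto a halfspace, the algorithm well defined
(`existsUnique_isRun`). With `T = C + P` it replaces maximal monotonicity of `A + C` in the proof
that weak limits are zeros (`IsMaximallyMonotone.mem_zer_of_tendsto`).

*Separation.* Cocoercivity and Young's inequality place `zer (A + C)` inside every halfspace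
(`IsMonotone.mem_halfspace`), so a relaxed projection onto the halfspace brings the iterate closer
to each zero, with a decrease controlled by the distance to the halfspace
(`IsPosDef.pnorm_relaxed_sub_sq_le`). As `β < 4`, that distance is at least a fixed multiple of
`‖x k - xh k‖` (`mul_norm_sub_le_of_mem_halfspace`). The decreases are summable, so the residuals
vanish (`IsRun.tendsto_sub_zero`). Then `M k (x k) - M k (xh k) - (C (x k) - C (xh k))`, an element
of `(A + C) (xh k)`, tends to `0`, every weak limit along an ultrafilter is a zero, and Opial's
lemma in the norm of `S` (`IsPosDef.exists_tendsto_inner_of_tendsto_pnorm`) gives weak convergence.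
-/

namespace NOFOB

section

/-! ### Minimization of a strongly convex functional over a closed convex set -/

/-- If the functional `(v, t) ↦ t + ‖v‖² / 2` is bounded below on a closed convex set `E`, then it
attains its minimum there: minimizing sequences are Cauchy by the parallelogram law. The conclusion
is the first-order optimality condition at a minimizer. -/
theorem exists_forall_inner_le_of_isClosed_convex {V : Type*} [NormedAddCommGroup V]
    [InnerProductSpace ℝ V] [CompleteSpace V] {E : Set (V × ℝ)} (hne : E.Nonempty)
    (hcl : IsClosed E) (hcv : Convex ℝ E) {b : ℝ}
    (hb : ∀ z ∈ E, b ≤ z.2 + ‖z.1‖ ^ 2 / 2) :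
    ∃ z₀ ∈ E, ∀ z ∈ E, z₀.2 - inner ℝ z₀.1 (z.1 - z₀.1) ≤ z.2 := by
  set g : V × ℝ → ℝ := fun z => z.2 + ‖z.1‖ ^ 2 / 2 with hg
  have hbdd : BddBelow (g '' E) := ⟨b, by rintro _ ⟨z, hz, rfl⟩; exact hb z hz⟩
  set m := sInf (g '' E) with hm
  have hmle : ∀ z ∈ E, m ≤ g z := fun z hz => csInf_le hbdd ⟨z, hz, rfl⟩
  have hex : ∀ n : ℕ, ∃ z ∈ E, g z < m + 1 / ((n : ℝ) + 1) := by
    intro n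
    obtain ⟨_, ⟨z, hz, rfl⟩, h⟩ := exists_lt_of_csInf_lt (hne.image g)
      (show sInf (g '' E) < m + 1 / ((n : ℝ) + 1) by
        rw [← hm]; linarith [Nat.one_div_pos_of_nat (α := ℝ) (n := n)])
    exact ⟨z, hz, h⟩
  choose z hzE hz using hex
  have hmid : ∀ i j, ‖(z i).1 - (z j).1‖ ^ 2 ≤ 8 * ((g (z i) + g (z j)) / 2 - m) := by
    intro i j
    have h1 := hmle _ (hcv (hzE i) (hzE j) (a := 1 / 2) (b := 1 / 2)
      (by norm_num) (by norm_num) (by norm_num))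
    have h2 := parallelogram_law_with_norm ℝ (z i).1 (z j).1
    have h3 : ‖(1 / 2 : ℝ) • (z i).1 + (1 / 2 : ℝ) • (z j).1‖ ^ 2
        = ‖(z i).1 + (z j).1‖ ^ 2 / 4 := by
      rw [← smul_add, norm_smul, mul_pow]; norm_num; ring
    simp only [hg, Prod.fst_add, Prod.snd_add, Prod.smul_fst, Prod.smul_snd, h3,
      smul_eq_mul] at h1 ⊢
    nlinarith
  have hcau : CauchySeq fun n => (z n).1 := by
    refine cauchySeq_of_le_tendsto_0 (fun N : ℕ => Real.sqrt (8 * (1 / ((N : ℝ) + 1)))) ?_ ?_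
    · intro i j N hi hj
      rw [dist_eq_norm]
      apply Real.le_sqrt_of_sq_le
      have h1 : (1 : ℝ) / ((i : ℝ) + 1) ≤ 1 / ((N : ℝ) + 1) :=
        Nat.one_div_le_one_div hi
      have h2 : (1 : ℝ) / ((j : ℝ) + 1) ≤ 1 / ((N : ℝ) + 1) :=
        Nat.one_div_le_one_div hj
      linarith [hmid i j, hz i, hz j]
    · have := (tendsto_one_div_add_atTop_nhds_zero_nat (𝕜 := ℝ)).const_mul 8
      simpa using this.sqrt
  obtain ⟨v₀, hv₀⟩ := cauchySeq_tendsto_of_complete hcau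
  have hgt : Tendsto (fun n => g (z n)) atTop (𝓝 m) := by
    refine tendsto_of_tendsto_of_tendsto_of_le_of_le (tendsto_const_nhds (x := m))
      (h := fun n : ℕ => m + 1 / ((n : ℝ) + 1)) ?_ (fun n => hmle _ (hzE n)) fun n => (hz n).le
    simpa using (tendsto_one_div_add_atTop_nhds_zero_nat (𝕜 := ℝ)).const_add m
  have ht : Tendsto (fun n => (z n).2) atTop (𝓝 (m - ‖v₀‖ ^ 2 / 2)) := by
    have := hgt.sub ((hv₀.norm.pow 2).div_const 2)
    simpa [hg] using this
  have hE₀ : (v₀, m - ‖v₀‖ ^ 2 / 2) ∈ E :=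
    hcl.mem_of_tendsto (hv₀.prodMk_nhds ht) (Eventually.of_forall hzE)
  refine ⟨_, hE₀, fun w hw => ?_⟩
  simp only
  by_contra! hlt
  set X : ℝ := w.2 - (m - ‖v₀‖ ^ 2 / 2 - inner ℝ v₀ (w.1 - v₀)) with hX
  have hX0 : X < 0 := by linarith
  set c : ℝ := ‖w.1 - v₀‖ ^ 2 / 2 with hc
  have hc0 : 0 ≤ c := by positivity
  -- with this step `s` from the minimizer towards `w`, the functional changes by `s (X + s c) < 0`
  set s : ℝ := -X / (c - X) with hs
  have hs0 : 0 < s := div_pos (by linarith) (by linarith)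
  have hs1 : s ≤ 1 := (div_le_one (by linarith)).2 (by linarith)
  have hsc : s * (c - X) = -X := div_mul_cancel₀ _ (by linarith)
  have h1 := hmle _ (hcv hE₀ hw (a := 1 - s) (b := s) (by linarith) hs0.le (by ring))
  have h2 : (1 - s) • v₀ + s • w.1 = v₀ + s • (w.1 - v₀) := by module
  simp only [hg, Prod.fst_add, Prod.snd_add, Prod.smul_fst, Prod.smul_snd, smul_eq_mul, h2,
    norm_add_sq_real, norm_smul, inner_smul_right, mul_pow, Real.norm_eq_abs, sq_abs] at h1
  have h3 : 0 ≤ s * (X + s * c) := by rw [hX, hc]; nlinarith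
  have h4 : 0 ≤ X + s * c := nonneg_of_mul_nonneg_right h3 hs0
  nlinarith

variable {H : Type*} [NormedAddCommGroup H] [InnerProductSpace ℝ H]

/-! ### Surjectivity theorems for maximally monotone operators -/

/-- A point of `H × H` that is monotonically related to the graph of a maximally monotone operator
belongs to that graph. -/
theorem IsMaximallyMonotone.mem {A : H → Set H} (hA : IsMaximallyMonotone A) {x u : H}
    (h : ∀ y v, v ∈ A y → 0 ≤ inner ℝ (u - v) (x - y)) : u ∈ A x := by
  have hB : IsMonotone fun y => A y ∪ {w | y = x ∧ w = u} := by
    rintro y w y' w' (hw | ⟨rfl, rfl⟩) (hw' | ⟨rfl, rfl⟩)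
    · exact hA.1 hw hw'
    · rw [← neg_sub w', ← neg_sub y', inner_neg_neg]; exact h _ _ hw
    · exact h _ _ hw'
    · simp
  rw [← hA.2 _ hB fun y => Set.subset_union_left]
  exact Or.inr ⟨rfl, rfl⟩

/-- Minty's surjectivity theorem, for a monotone operator `A` whose graph contains every point that
is monotonically related to it: `0` belongs to the range of `A + Id`.

The set `E` in the proof is the epigraph of the Fitzpatrick function
`F (x, u) = sup {⟪y, u⟫ + ⟪x, v⟫ - ⟪y, v⟫ | v ∈ A y}`, which dominates `⟪x, u⟫` and equals it on the
graph of `A`. At a minimizer `(x, u)` of `F + ‖·‖² / 2`, the optimality condition makes `(-u, -x)`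
monotonically related to `A`, and then forces `u = -x`. -/
theorem exists_neg_mem [CompleteSpace H] {A : H → Set H}
    (hmon : IsMonotone A)
    (hmax : ∀ x u : H, (∀ y v, v ∈ A y → 0 ≤ inner ℝ (u - v) (x - y)) → u ∈ A x) :
    ∃ x, -x ∈ A x := by
  set E : Set (WithLp 2 (H × H) × ℝ) :=
    {z | ∀ y v, v ∈ A y → inner ℝ y z.1.snd + inner ℝ z.1.fst v - inner ℝ y v ≤ z.2} with hE
  have hgraph : ∀ y v, v ∈ A y → (WithLp.toLp 2 (y, v), inner ℝ y v) ∈ E := by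
    intro y v hv y' v' hv'
    have := hmon hv hv'
    simp only [inner_sub_left, inner_sub_right] at this
    simp only [WithLp.toLp_fst, WithLp.toLp_snd]
    linarith [real_inner_comm y v, real_inner_comm y' v', real_inner_comm y v',
      real_inner_comm y' v]
  have hle : ∀ z ∈ E, inner ℝ z.1.fst z.1.snd ≤ z.2 := by
    intro z hz
    by_contra! hlt
    have hmem : z.1.snd ∈ A z.1.fst := by
      refine hmax _ _ fun y v hv => ?_
      have := hz y v hv
      simp only [inner_sub_left, inner_sub_right]
      linarith [real_inner_comm y v, real_inner_comm y z.1.snd, real_inner_comm z.1.fst v,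
        real_inner_comm z.1.fst z.1.snd]
    have := hz _ _ hmem
    linarith
  have hne : E.Nonempty := by
    have : ∃ y v, v ∈ A y := by
      by_contra! h
      exact h 0 0 (hmax 0 0 fun y v hv => absurd hv (h y v))
    obtain ⟨y, v, hv⟩ := this
    exact ⟨_, hgraph y v hv⟩
  have hcl : IsClosed E := by
    simp only [hE, Set.ofPred_forall]
    refine isClosed_iInter fun y => isClosed_iInter fun v => isClosed_iInter fun _ =>
      isClosed_le ?_ continuous_snd
    have h1 : Continuous fun z : WithLp 2 (H × H) × ℝ => z.1.snd :=
      (WithLp.sndL 2 ℝ H H).continuous.comp continuous_fst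
    have h2 : Continuous fun z : WithLp 2 (H × H) × ℝ => z.1.fst :=
      (WithLp.fstL 2 ℝ H H).continuous.comp continuous_fst
    fun_prop
  have hcv : Convex ℝ E := by
    intro z hz z' hz' a b ha hb hab y v hv
    have h1 := mul_le_mul_of_nonneg_left (hz y v hv) ha
    have h2 := mul_le_mul_of_nonneg_left (hz' y v hv) hb
    simp only [Prod.fst_add, Prod.snd_add, Prod.smul_fst, Prod.smul_snd, WithLp.add_fst,
      WithLp.add_snd, WithLp.smul_fst, WithLp.smul_snd, inner_add_left, inner_add_right,
      inner_smul_left, inner_smul_right, smul_eq_mul, RCLike.conj_to_real]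
    have h3 : inner ℝ y v = a * inner ℝ y v + b * inner ℝ y v := by rw [← add_mul, hab, one_mul]
    linarith
  have hsq : ∀ z : WithLp 2 (H × H), ‖z‖ ^ 2 = ‖z.fst‖ ^ 2 + ‖z.snd‖ ^ 2 :=
    fun z => WithLp.prod_norm_sq_eq_of_L2 z
  obtain ⟨z₀, hz₀, hopt⟩ := exists_forall_inner_le_of_isClosed_convex (b := 0) hne hcl hcv (by
    intro z hz
    have h1 := hle z hz
    have h2 := norm_add_sq_real z.1.fst z.1.snd
    rw [hsq]
    nlinarith [sq_nonneg ‖z.1.fst + z.1.snd‖])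
  set x := z₀.1.fst with hx
  set u := z₀.1.snd with hu
  have key : ∀ y v, v ∈ A y → ‖x + u‖ ^ 2 ≤ inner ℝ (-x - v) (-u - y) := by
    intro y v hv
    have h1 := hopt _ (hgraph y v hv)
    have h2 := hle z₀ hz₀
    have h3 := norm_add_sq_real x u
    simp only [WithLp.prod_inner_apply, ← hx, ← hu, inner_sub_right, real_inner_self_eq_norm_sq,
      WithLp.ofLp_fst, WithLp.ofLp_snd] at h1 h2
    simp only [inner_sub_left, inner_sub_right, inner_neg_left, inner_neg_right]
    linarith [real_inner_comm y v, real_inner_comm u v, real_inner_comm x y, real_inner_comm x u]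
  have hmem : -x ∈ A (-u) := hmax _ _ fun y v hv => (sq_nonneg _).trans (key y v hv)
  have h0 := key _ _ hmem
  simp only [sub_self, inner_zero_left] at h0
  have hxu : x + u = 0 := norm_eq_zero.1 (pow_eq_zero_iff two_ne_zero |>.1
    (le_antisymm h0 (sq_nonneg _)))
  refine ⟨x, ?_⟩
  rwa [← eq_neg_of_add_eq_zero_left hxu] at hmem

/-- The resolvent of index `γ` of a maximally monotone operator is defined everywhere. -/
theorem IsMaximallyMonotone.exists_inv_smul_sub_mem [CompleteSpace H] {A : H → Set H}
    (hA : IsMaximallyMonotone A) {γ : ℝ} (hγ : 0 < γ) (z : H) : ∃ x, γ⁻¹ • (z - x) ∈ A x := by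
  have hγ' : 0 < γ⁻¹ := inv_pos.2 hγ
  obtain ⟨x, hx⟩ := exists_neg_mem (A := fun x => {w | γ⁻¹ • (w + z) ∈ A x})
    (fun x u y v hu hv => by
      have h := hA.1 hu hv
      rw [← smul_sub, add_sub_add_right_eq_sub, inner_smul_left] at h
      exact nonneg_of_mul_nonneg_right h hγ')
    (fun x u h => hA.mem fun y v hv => by
      have h1 := h y (γ • v - z) (by
        rwa [Set.mem_ofPred_eq, sub_add_cancel, smul_smul, inv_mul_cancel₀ hγ.ne', one_smul])
      have h2 : γ⁻¹ • (u + z) - v = γ⁻¹ • (u - (γ • v - z)) := by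
        rw [smul_sub, smul_sub, smul_smul, inv_mul_cancel₀ hγ.ne', smul_add]; module
      rw [h2, inner_smul_left]
      exact mul_nonneg hγ'.le h1)
  exact ⟨x, by rwa [Set.mem_ofPred_eq, neg_add_eq_sub] at hx⟩

/-- If `A` is maximally monotone and `T` is strongly monotone and Lipschitz continuous, then `A + T`
is surjective: `w - T x ∈ A x` says that `x` is a fixed point of
`x ↦ (Id + γ A)⁻¹ (x - γ (T x - w))`, which is a contraction for small `γ > 0`. -/
theorem IsMaximallyMonotone.exists_sub_mem [CompleteSpace H] {A : H → Set H}
    (hA : IsMaximallyMonotone A) {T : H → H} {σ K : ℝ} (hσ : 0 < σ)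
    (hT : ∀ x y, σ * ‖x - y‖ ^ 2 ≤ inner ℝ (T x - T y) (x - y))
    (hK : ∀ x y, ‖T x - T y‖ ≤ K * ‖x - y‖) (w : H) : ∃ x, w - T x ∈ A x := by
  have hD : 0 < K ^ 2 + σ ^ 2 := by positivity
  -- the squared contraction factor `1 - 2 γ σ + γ² K²` is then at most `q` below
  set γ : ℝ := σ / (K ^ 2 + σ ^ 2) with hγ
  have hγ0 : 0 < γ := by positivity
  choose J hJ using hA.exists_inv_smul_sub_mem hγ0
  have hJne : ∀ a b, ‖J a - J b‖ ≤ ‖a - b‖ := by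
    intro a b
    have h := hA.1 (hJ a) (hJ b)
    have h2 : a - J a - (b - J b) = (a - b) - (J a - J b) := by abel
    rw [← smul_sub, inner_smul_left, h2] at h
    have h1 := nonneg_of_mul_nonneg_right h (inv_pos.2 hγ0)
    rw [inner_sub_left, real_inner_self_eq_norm_sq] at h1
    have h3 := real_inner_le_norm (a - b) (J a - J b)
    rcases (norm_nonneg (J a - J b)).eq_or_lt with h4 | h4
    · rw [← h4]; positivity
    · nlinarith
  set q : ℝ := K ^ 2 / (K ^ 2 + σ ^ 2) with hq
  have hq0 : 0 ≤ q := by positivity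
  have hq1 : q < 1 := (div_lt_one hD).2 (by nlinarith)
  have hstep : ∀ x y, ‖(x - γ • (T x - w)) - (y - γ • (T y - w))‖ ≤ Real.sqrt q * ‖x - y‖ := by
    intro x y
    have h1 : (x - γ • (T x - w)) - (y - γ • (T y - w)) = (x - y) - γ • (T x - T y) := by module
    have h2 : ‖(x - y) - γ • (T x - T y)‖ ^ 2 ≤ q * ‖x - y‖ ^ 2 := by
      rw [norm_sub_sq_real, inner_smul_right, norm_smul, mul_pow, Real.norm_eq_abs, sq_abs,
        real_inner_comm]
      have h3 := hT x y
      have h4 : ‖T x - T y‖ ^ 2 ≤ (K ^ 2 + σ ^ 2) * ‖x - y‖ ^ 2 := by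
        have := pow_le_pow_left₀ (norm_nonneg _) (hK x y) 2
        rw [mul_pow] at this
        nlinarith [mul_nonneg (sq_nonneg σ) (sq_nonneg ‖x - y‖)]
      have h5 : γ * (K ^ 2 + σ ^ 2) = σ := div_mul_cancel₀ _ hD.ne'
      have h6 : q = 1 - γ * σ := by rw [hq, hγ]; field_simp; ring
      have h7 : γ ^ 2 * ‖T x - T y‖ ^ 2 ≤ γ * σ * ‖x - y‖ ^ 2 := by
        calc γ ^ 2 * ‖T x - T y‖ ^ 2 ≤ γ ^ 2 * ((K ^ 2 + σ ^ 2) * ‖x - y‖ ^ 2) := by gcongr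
          _ = γ * (γ * (K ^ 2 + σ ^ 2)) * ‖x - y‖ ^ 2 := by ring
          _ = _ := by rw [h5]
      have h8 := mul_le_mul_of_nonneg_left h3 hγ0.le
      rw [h6]
      linarith
    rw [h1]
    refine le_of_sq_le_sq ?_ (by positivity)
    rwa [mul_pow, Real.sq_sqrt hq0]
  have hΦ : ContractingWith (Real.toNNReal (Real.sqrt q))
      fun x => J (x - γ • (T x - w)) := by
    refine ⟨?_, LipschitzWith.of_dist_le_mul fun x y => ?_⟩
    · rw [Real.toNNReal_lt_one, Real.sqrt_lt' one_pos]; simpa using hq1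
    · rw [dist_eq_norm, dist_eq_norm, Real.coe_toNNReal _ (Real.sqrt_nonneg _)]
      exact (hJne _ _).trans (hstep x y)
  refine ⟨hΦ.fixedPoint, ?_⟩
  have hfix := hΦ.fixedPoint_isFixedPt
  set x := hΦ.fixedPoint
  have h := hJ (x - γ • (T x - w))
  rw [show J (x - γ • (T x - w)) = x from hfix] at h
  rwa [sub_sub_cancel_left, ← smul_neg, smul_smul, inv_mul_cancel₀ hγ0.ne', one_smul,
    neg_sub] at h

end

section

variable {H : Type*} [NormedAddCommGroup H] [InnerProductSpace ℝ H]

/-! ### Membership in the operators of the algorithm -/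

theorem mem_fbMap_iff {E : Type*} [NormedAddCommGroup E] {A : E → Set E} {C M : E → E}
    {x y : E} : y ∈ fbMap A C M x ↔ M x - C x - M y ∈ A y := by
  simp only [fbMap, inv, single, Set.mem_ofPred_eq, Pi.add_apply, Set.singleton_add,
    Set.mem_image]
  exact ⟨fun ⟨u, hu, h⟩ => by rwa [← h, add_sub_cancel_left], fun h => ⟨_, h, by abel⟩⟩

theorem mem_zer_add_single_iff {E : Type*} [NormedAddCommGroup E] {A : E → Set E} {C : E → E}
    {z : E} : z ∈ zer (A + single C) ↔ -C z ∈ A z := by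
  simp only [zer, single, Set.mem_ofPred_eq, Pi.add_apply, Set.add_singleton, Set.mem_image]
  exact ⟨fun ⟨u, hu, h⟩ => by rwa [← eq_neg_of_add_eq_zero_left h], fun h => ⟨_, h, by abel⟩⟩

theorem continuous_pnorm (S : H →L[ℝ] H) : Continuous (pnorm S) := by
  unfold pnorm; fun_prop

theorem IsStronglyMonotone.pnorm_sq_le {P : H →L[ℝ] H} {M : H → H}
    (hM : IsStronglyMonotone 1 P (single M)) (x y : H) :
    pnorm P (x - y) ^ 2 ≤ inner ℝ (M x - M y) (x - y) := by
  simpa using hM.2 (x := x) (y := y) (Set.mem_singleton _) (Set.mem_singleton _)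

variable [CompleteSpace H]

/-! ### The norm of a positive definite operator -/

namespace IsPosDef

variable {S : H →L[ℝ] H}

theorem inner_apply_comm (hS : IsPosDef S) (x y : H) : inner ℝ x (S y) = inner ℝ y (S x) := by
  rw [real_inner_comm, ← ContinuousLinearMap.adjoint_inner_right, hS.selfAdjoint.adjoint_eq]

theorem inner_self_nonneg (hS : IsPosDef S) (x : H) : 0 ≤ inner ℝ x (S x) := by
  obtain ⟨lam, hlam, h⟩ := hS.lower
  exact (by positivity : (0 : ℝ) ≤ lam * ‖x‖ ^ 2).trans (h x)

theorem pnorm_sq (hS : IsPosDef S) (x : H) : pnorm S x ^ 2 = inner ℝ x (S x) :=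
  Real.sq_sqrt (hS.inner_self_nonneg x)

theorem eq_zero_of_inner_self_nonpos (hS : IsPosDef S) {x : H} (hx : inner ℝ x (S x) ≤ 0) :
    x = 0 := by
  obtain ⟨lam, hlam, h⟩ := hS.lower
  have h1 : lam * ‖x‖ ^ 2 ≤ 0 := (h x).trans hx
  have h2 : ‖x‖ ^ 2 ≤ 0 := nonpos_of_mul_nonpos_right h1 hlam
  simpa using le_antisymm h2 (sq_nonneg _)

theorem inner_add_self (hS : IsPosDef S) (x y : H) :
    inner ℝ (x + y) (S (x + y)) = inner ℝ x (S x) + 2 * inner ℝ x (S y) + inner ℝ y (S y) := by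
  rw [map_add, inner_add_left, inner_add_right, inner_add_right, hS.inner_apply_comm y x]
  ring

theorem pnorm_inverse_sq (hS : IsPosDef S) (d : H) :
    pnorm S.inverse d ^ 2 = inner ℝ (S.inverse d) (S (S.inverse d)) := by
  have h := hS.isInvertible.self_apply_inverse d
  have h1 : inner ℝ d (S.inverse d) = inner ℝ (S.inverse d) (S (S.inverse d)) := by
    rw [h, real_inner_comm]
  rw [pnorm, h1, Real.sq_sqrt (hS.inner_self_nonneg _)]

end IsPosDef

/-! ### Projection onto a halfspace in the norm of a positive definite operator -/

/-- The projection of `x` onto the halfspace `{z | ⟪n, z - a⟫ ≤ c}` in the norm of `S`, described by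
its variational inequality: it is `x - t S⁻¹ n` with
`t = max 0 (⟪n, x - a⟫ - c) / ⟪n, S⁻¹ n⟫`. -/
theorem IsPosDef.exists_halfspace_projection {S : H →L[ℝ] H} (hS : IsPosDef S) (n a x : H) {c : ℝ}
    (hc : 0 ≤ c) :
    ∃ p, inner ℝ n (p - a) ≤ c ∧
      ∀ z, inner ℝ n (z - a) ≤ c → inner ℝ (z - p) (S (x - p)) ≤ 0 := by
  by_cases hx : inner ℝ n (x - a) ≤ c
  · exact ⟨x, hx, fun z _ => by simp⟩
  push Not at hx
  set r := S.inverse n with hr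
  have hSr : S r = n := hS.isInvertible.self_apply_inverse n
  have hpos : 0 < inner ℝ n r := by
    by_contra! h
    have h0 : r = 0 := hS.eq_zero_of_inner_self_nonpos (by rwa [hSr, real_inner_comm])
    rw [h0, map_zero] at hSr
    rw [← hSr, inner_zero_left] at hx
    linarith
  set t := (inner ℝ n (x - a) - c) / inner ℝ n r with ht
  have ht0 : 0 ≤ t := div_nonneg (by linarith) hpos.le
  have hpa : inner ℝ n (x - t • r - a) = c := by
    have h1 : x - t • r - a = (x - a) - t • r := by abel
    rw [h1, inner_sub_right, inner_smul_right, ht, div_mul_cancel₀ _ hpos.ne']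
    ring
  refine ⟨x - t • r, hpa.le, fun z hz => ?_⟩
  have h2 : z - (x - t • r) = (z - a) - (x - t • r - a) := by abel
  rw [sub_sub_cancel, map_smul, hSr, inner_smul_right, real_inner_comm, h2, inner_sub_right, hpa]
  exact mul_nonpos_of_nonneg_of_nonpos ht0 (by linarith)

theorem IsPosDef.proj_eq_singleton {S : H →L[ℝ] H} (hS : IsPosDef S) {D : Set H} {x p : H}
    (hp : p ∈ D) (h : ∀ z ∈ D, inner ℝ (z - p) (S (x - p)) ≤ 0) : proj S D x = {p} := by
  have key : ∀ z ∈ D, pnorm S (x - p) ^ 2 + pnorm S (p - z) ^ 2 ≤ pnorm S (x - z) ^ 2 := by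
    intro z hz
    have h1 := hS.inner_add_self (x - p) (p - z)
    rw [sub_add_sub_cancel] at h1
    have h2 := h z hz
    have h3 : inner ℝ (p - z) (S (x - p)) = -inner ℝ (z - p) (S (x - p)) := by
      rw [← neg_sub z p, inner_neg_left]
    rw [hS.inner_apply_comm (x - p) (p - z), h3] at h1
    rw [hS.pnorm_sq, hS.pnorm_sq, hS.pnorm_sq, h1]
    linarith
  ext q
  refine ⟨fun ⟨hqD, hq⟩ => ?_, ?_⟩
  · have h1 : pnorm S (x - q) ^ 2 ≤ pnorm S (x - p) ^ 2 :=
      pow_le_pow_left₀ (Real.sqrt_nonneg _) (hq p hp) 2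
    have h2 := key q hqD
    have h3 : p - q = 0 :=
      hS.eq_zero_of_inner_self_nonpos (by rw [← hS.pnorm_sq]; linarith)
    exact (sub_eq_zero.1 h3).symm
  · rintro rfl
    refine ⟨hp, fun z hz => le_of_sq_le_sq ?_ (Real.sqrt_nonneg _)⟩
    nlinarith [key z hz, sq_nonneg (pnorm S (q - z))]

variable {A : H → Set H} {C M : H → H} {β : ℝ} {P S : H →L[ℝ] H}

/-- The halfspaces of the algorithm are nonempty, as `β ≥ 0`, so the projection onto them is
single-valued; it satisfies the variational inequality. -/
theorem exists_proj_halfspace_eq_singleton (hS : IsPosDef S) (hβ : 0 ≤ β)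
    (M : H → H) (x xh : H) :
    ∃ p ∈ halfspace β P M x xh, (∀ z ∈ halfspace β P M x xh, inner ℝ (z - p) (S (x - p)) ≤ 0) ∧
      proj S (halfspace β P M x xh) x = {p} := by
  obtain ⟨p, hp, h⟩ := hS.exists_halfspace_projection (M x - M xh) xh x
    (show 0 ≤ β / 4 * pnorm P (x - xh) ^ 2 by positivity)
  exact ⟨p, hp, h, hS.proj_eq_singleton hp h⟩

/-- Relaxed projections onto a set are quasi-nonexpansive, with a quantitative decrease. -/
theorem IsPosDef.pnorm_relaxed_sub_sq_le (hS : IsPosDef S) {x p z : H} {θ : ℝ} (hθ : 0 ≤ θ)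
    (h : inner ℝ (z - p) (S (x - p)) ≤ 0) :
    pnorm S ((1 - θ) • x + θ • p - z) ^ 2
      ≤ pnorm S (x - z) ^ 2 - θ * (2 - θ) * pnorm S (x - p) ^ 2 := by
  have h1 : (1 - θ) • x + θ • p - z = (x - z) + (-θ) • (x - p) := by module
  have h2 : inner ℝ (x - z) (S (x - p))
      = inner ℝ (x - p) (S (x - p)) - inner ℝ (z - p) (S (x - p)) := by
    rw [← inner_sub_left, sub_sub_sub_cancel_right]
  rw [h1, hS.pnorm_sq, hS.pnorm_sq, hS.pnorm_sq, hS.inner_add_self, map_smul, inner_smul_left,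
    inner_smul_right, inner_smul_right, h2, RCLike.conj_to_real]
  nlinarith [mul_nonneg hθ (neg_nonneg.2 h)]

/-! ### Cocoercive operators -/

theorem IsInvCocoercive.eq_of_eq_zero (hP : IsPosDef P) (hC : IsInvCocoercive 0 P C) (x y : H) :
    C x = C y := by
  have h := hC.2 x y
  rw [hP.pnorm_inverse_sq, zero_mul] at h
  rw [← sub_eq_zero, ← hP.isInvertible.self_apply_inverse (C x - C y),
    hP.eq_zero_of_inner_self_nonpos h, map_zero]

theorem IsInvCocoercive.inner_nonneg (hP : IsPosDef P) (hC : IsInvCocoercive β P C) (x y : H) :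
    0 ≤ inner ℝ (C x - C y) (x - y) := by
  rcases hC.1.eq_or_lt with rfl | hβ
  · simp [hC.eq_of_eq_zero hP x y]
  · exact nonneg_of_mul_nonneg_right ((sq_nonneg _).trans (hC.2 x y)) hβ

theorem IsInvCocoercive.exists_lipschitz (hP : IsPosDef P) (hC : IsInvCocoercive β P C) :
    ∃ K, ∀ x y, ‖C x - C y‖ ≤ K * ‖x - y‖ := by
  obtain ⟨lam, hlam, hlow⟩ := hP.lower
  refine ⟨‖P‖ * (β * ‖P‖ / lam), fun x y => ?_⟩
  set d := C x - C y with hd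
  set r := P.inverse d with hr
  have hPr : P r = d := hP.isInvertible.self_apply_inverse d
  have h1 := hC.2 x y
  rw [hP.pnorm_inverse_sq, ← hd, ← hr] at h1
  have h2 : ‖d‖ ≤ ‖P‖ * ‖r‖ := hPr ▸ P.le_opNorm r
  have h3 : lam * ‖r‖ ^ 2 ≤ β * (‖P‖ * ‖r‖ * ‖x - y‖) :=
    (hlow r).trans <| h1.trans <| mul_le_mul_of_nonneg_left
      ((real_inner_le_norm _ _).trans (by gcongr)) hC.1
  have h4 : ‖r‖ ≤ β * ‖P‖ / lam * ‖x - y‖ := by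
    rw [div_mul_eq_mul_div, le_div_iff₀ hlam]
    have := hC.1
    rcases (norm_nonneg r).eq_or_lt with h0 | h0
    · rw [← h0]; simp only [zero_mul]; positivity
    · nlinarith
  calc ‖d‖ ≤ ‖P‖ * ‖r‖ := h2
    _ ≤ ‖P‖ * (β * ‖P‖ / lam * ‖x - y‖) := by gcongr
    _ = _ := by ring

/-- Young's inequality for the pairing of `P⁻¹` and `P` norms, combined with cocoercivity. -/
theorem IsInvCocoercive.inner_sub_le (hP : IsPosDef P) (hC : IsInvCocoercive β P C) (x z w : H) :
    inner ℝ (C x - C z) (z - w) ≤ β / 4 * pnorm P (x - w) ^ 2 := by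
  rcases hC.1.eq_or_lt with rfl | hβ
  · simp [hC.eq_of_eq_zero hP x z]
  set d := C x - C z with hd
  set r := P.inverse d with hr
  have hPr : P r = d := hP.isInvertible.self_apply_inverse d
  have h1 := hC.2 x z
  rw [hP.pnorm_inverse_sq, ← hd, ← hr] at h1
  -- expand `0 ≤ ‖P⁻¹ d - (β / 2) (x - w)‖²` in the norm of `P`
  have h2 := hP.inner_self_nonneg ((-(β / 2)) • (x - w) + r)
  rw [hP.inner_add_self, hPr, map_smul, inner_smul_left, inner_smul_left, inner_smul_right,
    RCLike.conj_to_real] at h2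
  rw [hPr] at h1
  have h3 : inner ℝ d (z - w) = inner ℝ (x - w) d - inner ℝ d (x - z) := by
    rw [real_inner_comm d, ← inner_sub_right, sub_sub_sub_cancel_left]
  rw [hP.pnorm_sq, h3]
  have h4 : β * (inner ℝ (x - w) d - inner ℝ d (x - z))
      ≤ β * (β / 4 * inner ℝ (x - w) (P (x - w))) := by linarith
  exact le_of_mul_le_mul_left h4 hβ

/-! ### The forward-backward map -/

/-- A single-valued, Lipschitz continuous, strongly monotone kernel makes the forward-backward map
single-valued with full domain. -/
theorem IsMaximallyMonotone.existsUnique_mem_fbMap (hA : IsMaximallyMonotone A) (hP : IsPosDef P)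
    (hM : IsStronglyMonotone 1 P (single M)) {L : NNReal} (hL : LipschitzWith L M) (x : H) :
    ∃! y, y ∈ fbMap A C M x := by
  obtain ⟨lam, hlam, hlow⟩ := hP.lower
  obtain ⟨y, hy⟩ := hA.exists_sub_mem hlam
    (fun a b => (hlow (a - b)).trans (hP.pnorm_sq _ ▸ hM.pnorm_sq_le a b))
    (fun a b => by simpa [dist_eq_norm] using hL.dist_le_mul a b) (M x - C x)
  refine ⟨y, mem_fbMap_iff.2 hy, fun w hw => ?_⟩
  have h1 := hA.1 (mem_fbMap_iff.1 hw) hy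
  have h2 := hM.pnorm_sq_le w y
  rw [sub_sub_sub_cancel_left, ← neg_sub (M w), inner_neg_left] at h1
  rw [hP.pnorm_sq] at h2
  exact sub_eq_zero.1 (hP.eq_zero_of_inner_self_nonpos (by linarith))

/-- Zeros of `A + C` belong to every halfspace that the algorithm builds. -/
theorem IsMonotone.mem_halfspace (hA : IsMonotone A) (hP : IsPosDef P)
    (hC : IsInvCocoercive β P C) {x xh z : H} (hxh : xh ∈ fbMap A C M x)
    (hz : z ∈ zer (A + single C)) : z ∈ halfspace β P M x xh := by
  have h1 := hA (mem_fbMap_iff.1 hxh) (mem_zer_add_single_iff.1 hz)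
  have h2 : M x - C x - M xh - -C z = (M x - M xh) - (C x - C z) := by abel
  rw [h2, inner_sub_left, ← neg_sub z xh, inner_neg_right, inner_neg_right] at h1
  exact (by linarith : inner ℝ (M x - M xh) (z - xh) ≤ inner ℝ (C x - C z) (z - xh)).trans
    (hC.inner_sub_le hP x z xh)

/-- The projection onto the halfspace moves the current point at least by a fixed multiple of
`‖x - xh‖`: the halfspace is separated from `x` because `β < 4`. -/
theorem mul_norm_sub_le_of_mem_halfspace {lam : ℝ} (hP : IsPosDef P)
    (hlow : ∀ x : H, lam * ‖x‖ ^ 2 ≤ inner ℝ x (P x)) (hβ : β < 4)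
    (hM : IsStronglyMonotone 1 P (single M)) {L : NNReal} (hL : LipschitzWith L M) {x xh p : H}
    (hp : p ∈ halfspace β P M x xh) :
    (1 - β / 4) * lam * ‖x - xh‖ ≤ L * ‖x - p‖ := by
  rcases (norm_nonneg (x - xh)).eq_or_lt with h0 | h0
  · rw [← h0, mul_zero]; positivity
  have h1 : inner ℝ (M x - M xh) (p - xh) ≤ β / 4 * pnorm P (x - xh) ^ 2 := hp
  have h2 := hM.pnorm_sq_le x xh
  have h3 : inner ℝ (M x - M xh) (x - p)
      = inner ℝ (M x - M xh) (x - xh) - inner ℝ (M x - M xh) (p - xh) := by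
    rw [← inner_sub_right, sub_sub_sub_cancel_right]
  have h4 : inner ℝ (M x - M xh) (x - p) ≤ L * ‖x - xh‖ * ‖x - p‖ :=
    (real_inner_le_norm _ _).trans (mul_le_mul_of_nonneg_right
      (by simpa [dist_eq_norm] using hL.dist_le_mul x xh) (norm_nonneg _))
  have h5 := hlow (x - xh)
  rw [← hP.pnorm_sq] at h5
  have h6 := mul_le_mul_of_nonneg_left h5 (by linarith : 0 ≤ 1 - β / 4)
  refine le_of_mul_le_mul_right ?_ h0
  nlinarith

end

section

variable {H : Type*} [NormedAddCommGroup H] [InnerProductSpace ℝ H] [CompleteSpace H]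

/-! ### Weak convergence -/

theorem tendsto_toWeakSpace_iff {ι : Type*} {l : Filter ι} {x : ι → H} {a : H} :
    Tendsto (fun k => toWeakSpace ℝ H (x k)) l (𝓝 (toWeakSpace ℝ H a)) ↔
      ∀ h, Tendsto (fun k => inner ℝ (x k) h) l (𝓝 (inner ℝ a h)) := by
  have hinj : Function.Injective (topDualPairing ℝ H).flip := fun u v huv =>
    ext_inner_left ℝ fun w => DFunLike.congr_fun huv (innerSL ℝ w)
  refine (WeakBilin.tendsto_iff_forall_eval_tendsto _ hinj).trans ⟨fun h w => ?_, fun h f => ?_⟩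
  · simp only [real_inner_comm w]
    exact h (innerSL ℝ w)
  · obtain ⟨w, rfl⟩ := (InnerProductSpace.toDual ℝ H).surjective f
    have := h w
    simp only [real_inner_comm w] at this
    exact this

/-- Along an ultrafilter, every bounded sequence of a Hilbert space converges weakly. -/
theorem exists_forall_tendsto_inner {ι : Type*} (U : Ultrafilter ι) {x : ι → H} {R : ℝ}
    (hx : ∀ k, ‖x k‖ ≤ R) :
    ∃ a, ∀ h, Tendsto (fun k => inner ℝ (x k) h) U (𝓝 (inner ℝ a h)) := by
  set f : ι → WeakDual ℝ H :=
    fun k => StrongDual.toWeakDual (InnerProductSpace.toDual ℝ H (x k)) with hf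
  have hmem : ((U.map f : Ultrafilter (WeakDual ℝ H)) : Filter (WeakDual ℝ H)) ≤
      𝓟 (WeakDual.toStrongDual ⁻¹' Metric.closedBall 0 R) := by
    rw [le_principal_iff, Ultrafilter.mem_coe, Ultrafilter.mem_map]
    refine Filter.univ_mem' fun k => ?_
    simpa [hf] using hx k
  obtain ⟨g, -, hg⟩ := (WeakDual.isCompact_closedBall (𝕜 := ℝ) (E := H) 0 R).ultrafilter_le_nhds
    _ hmem
  refine ⟨(InnerProductSpace.toDual ℝ H).symm (WeakDual.toStrongDual g), fun h => ?_⟩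
  have h1 := ((WeakDual.eval_continuous (𝕜 := ℝ) h).tendsto g).comp hg
  rw [InnerProductSpace.toDual_symm_apply]
  exact h1

/-- Opial's lemma in the norm of `S`: if the distances of a sequence to each point of `Z` converge,
and all weak limits of the bounded sequence along ultrafilters belong to `Z`, then the sequence
converges weakly. Two weak limits `a`, `b` agree because `⟪x k, S (a - b)⟫` converges. -/
theorem IsPosDef.exists_tendsto_inner_of_tendsto_pnorm {S : H →L[ℝ] H} (hS : IsPosDef S)
    {Z : Set H} {x : ℕ → H} {R : ℝ} (hx : ∀ k, ‖x k‖ ≤ R)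
    (hd : ∀ z ∈ Z, ∃ d : ℝ, Tendsto (fun k => pnorm S (x k - z)) atTop (𝓝 d))
    (hZ : ∀ (U : Ultrafilter ℕ) (a : H), (U : Filter ℕ) ≤ atTop →
      (∀ h, Tendsto (fun k => inner ℝ (x k) h) U (𝓝 (inner ℝ a h))) → a ∈ Z) :
    ∃ a ∈ Z, ∀ h, Tendsto (fun k => inner ℝ (x k) h) atTop (𝓝 (inner ℝ a h)) := by
  obtain ⟨a, ha⟩ := exists_forall_tendsto_inner (Ultrafilter.of (atTop : Filter ℕ)) hx
  have hle : ((Ultrafilter.of atTop : Ultrafilter ℕ) : Filter ℕ) ≤ atTop := Ultrafilter.of_le _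
  have haZ := hZ _ _ hle ha
  refine ⟨a, haZ, fun h => ?_⟩
  rw [tendsto_iff_ultrafilter]
  intro V hV
  obtain ⟨b, hb⟩ := exists_forall_tendsto_inner V hx
  have hbZ := hZ _ _ hV hb
  obtain ⟨da, hda⟩ := hd a haZ
  obtain ⟨db, hdb⟩ := hd b hbZ
  have hexp : ∀ k, inner ℝ (x k) (S (a - b)) = (pnorm S (x k - b) ^ 2 - pnorm S (x k - a) ^ 2
      + inner ℝ a (S a) - inner ℝ b (S b)) / 2 := by
    intro k
    rw [hS.pnorm_sq, hS.pnorm_sq, sub_eq_add_neg (x k) a, sub_eq_add_neg (x k) b,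
      hS.inner_add_self, hS.inner_add_self]
    simp only [map_sub, map_neg, inner_sub_right, inner_neg_left, inner_neg_right]
    ring
  have hlim : Tendsto (fun k => inner ℝ (x k) (S (a - b))) atTop
      (𝓝 ((db ^ 2 - da ^ 2 + inner ℝ a (S a) - inner ℝ b (S b)) / 2)) := by
    simp only [hexp]
    exact ((((hdb.pow 2).sub (hda.pow 2)).add_const _).sub_const _).div_const _
  have h1 := tendsto_nhds_unique (ha (S (a - b))) (hlim.mono_left hle)
  have h2 := tendsto_nhds_unique (hb (S (a - b))) (hlim.mono_left hV)
  have h3 : a - b = 0 := hS.eq_zero_of_inner_self_nonpos (by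
    rw [inner_sub_left, h1, h2, sub_self])
  rw [sub_eq_zero.1 h3]
  exact hb h

/-- The graph of `A + C` is closed for weak convergence of the points `y k` and strong convergence
to `0` of the values `u k + C (y k)`, where `u k ∈ A (y k)`. The proof compares `a` with the
solution `b` of `P a ∈ A b + C b + P b`, which exists by surjectivity. -/
theorem IsMaximallyMonotone.mem_zer_of_tendsto {ι : Type*} {l : Filter ι} [l.NeBot] {A : H → Set H}
    (hA : IsMaximallyMonotone A) {C : H → H} {β : ℝ} {P : H →L[ℝ] H} (hP : IsPosDef P)
    (hC : IsInvCocoercive β P C) {y u : ι → H} {a : H} {R : ℝ} (hy : ∀ k, ‖y k‖ ≤ R)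
    (hu : ∀ k, u k ∈ A (y k)) (hlim : Tendsto (fun k => u k + C (y k)) l (𝓝 0))
    (hya : ∀ h, Tendsto (fun k => inner ℝ (y k) h) l (𝓝 (inner ℝ a h))) :
    a ∈ zer (A + single C) := by
  obtain ⟨lam, hlam, hlow⟩ := hP.lower
  obtain ⟨K, hK⟩ := hC.exists_lipschitz hP
  obtain ⟨b, hb⟩ := hA.exists_sub_mem (T := fun z => C z + P z) (K := K + ‖P‖) hlam
    (fun p q => by
      rw [add_sub_add_comm, ← map_sub, inner_add_left, real_inner_comm _ (P _)]
      linarith [hlow (p - q), hC.inner_nonneg hP p q])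
    (fun p q => by
      rw [add_sub_add_comm, ← map_sub, add_mul]
      exact (norm_add_le _ _).trans (add_le_add (hK p q) (P.le_opNorm _))) (P a)
  have hk : ∀ k, 0 ≤ inner ℝ (b - y k) (P (a - b)) - inner ℝ (b - y k) (u k + C (y k)) := by
    intro k
    have h1 := hA.1 hb (hu k)
    have h2 := hC.inner_nonneg hP b (y k)
    have h3 : P a - (C b + P b) - u k = P (a - b) - (u k + C (y k)) - (C b - C (y k)) := by
      rw [map_sub]; abel
    rw [h3, inner_sub_left, real_inner_comm] at h1
    rw [← inner_sub_right]
    linarith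
  have hz : Tendsto (fun k => inner ℝ (b - y k) (u k + C (y k))) l (𝓝 0) := by
    refine squeeze_zero_norm (a := fun k => (‖b‖ + R) * ‖u k + C (y k)‖) (fun k => ?_) ?_
    · refine (norm_inner_le_norm _ _).trans (mul_le_mul_of_nonneg_right ?_ (norm_nonneg _))
      exact (norm_sub_le _ _).trans (by gcongr; exact hy k)
    · simpa using hlim.norm.const_mul (‖b‖ + R)
  have h0 : 0 ≤ inner ℝ (b - a) (P (a - b)) := by
    have h1 : Tendsto (fun k => inner ℝ (b - y k) (P (a - b))) l
        (𝓝 (inner ℝ (b - a) (P (a - b)))) := by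
      simp only [inner_sub_left]
      exact (hya _).const_sub _
    have h2 := ge_of_tendsto (h1.sub hz) (Eventually.of_forall hk)
    rwa [sub_zero] at h2
  have hab : a - b = 0 := hP.eq_zero_of_inner_self_nonpos (by
    rw [← neg_sub, inner_neg_left] at h0; linarith)
  rw [sub_eq_zero.1 hab, sub_add_cancel_right] at hb
  rw [mem_zer_add_single_iff, sub_eq_zero.1 hab]
  exact hb

/-! ### Existence and uniqueness of the iterates -/

variable {A : H → Set H} {C : H → H} {β : ℝ} {P S : H →L[ℝ] H} {M : ℕ → H → H} {L : NNReal}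
  {θ : ℕ → ℝ}

theorem existsUnique_isRun (hP : IsPosDef P) (hS : IsPosDef S) (hA : IsMaximallyMonotone A)
    (hβ : 0 ≤ β) (hM : ∀ k, IsStronglyMonotone 1 P (single (M k)))
    (hL : ∀ k, LipschitzWith L (M k)) (x₀ : H) :
    ∃! r : (ℕ → H) × (ℕ → H), r.1 0 = x₀ ∧ IsRun A C β P S M θ r.1 r.2 := by
  choose F hF hFu using fun k x => hA.existsUnique_mem_fbMap (C := C) hP (hM k) (hL k) x
  choose p _ _ hpr using fun k x =>
    exists_proj_halfspace_eq_singleton (P := P) hS hβ (M k) x (F k x)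
  set G : ℕ → H → H := fun k x => (1 - θ k) • x + θ k • p k x with hG
  set x : ℕ → H := fun n => Nat.rec x₀ (fun k y => G k y) n with hx
  refine ⟨(x, fun k => F k (x k)), ⟨rfl, fun k => hF k _, fun k => ⟨p k (x k), ?_, rfl⟩⟩, ?_⟩
  · rw [hpr]; rfl
  rintro ⟨y, yh⟩ ⟨hy0, hrun⟩
  simp only at hy0 hrun
  have hyh : ∀ k, yh k = F k (y k) := fun k => hFu k _ _ (hrun.forwardBackward k)
  have hyx : ∀ k, y k = x k := by
    intro k
    induction k with
    | zero => exact hy0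
    | succ k ih =>
      obtain ⟨q, hq, hyk⟩ := hrun.relaxedProjection k
      rw [hyh, hpr, Set.mem_singleton_iff] at hq
      rw [hyk, hq, ih]
  exact Prod.ext (funext hyx) (funext fun k => (hyh k).trans (by rw [hyx]))

/-! ### Asymptotic behaviour of the iterates -/

/-- The decrease of the squared distance to a zero of `A + C` in one step of the algorithm. -/
theorem IsRun.exists_sq_le (hP : IsPosDef P) (hS : IsPosDef S) (hA : IsMonotone A)
    (hC : IsInvCocoercive β P C) (hθ : ∀ k, θ k ∈ Set.Ioo (0 : ℝ) 2) {x xh : ℕ → H}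
    (hrun : IsRun A C β P S M θ x xh) (k : ℕ) :
    ∃ p ∈ halfspace β P (M k) (x k) (xh k), ∀ z ∈ zer (A + single C),
      pnorm S (x (k + 1) - z) ^ 2
        ≤ pnorm S (x k - z) ^ 2 - θ k * (2 - θ k) * pnorm S (x k - p) ^ 2 := by
  obtain ⟨p, hp, hvar, hpr⟩ :=
    exists_proj_halfspace_eq_singleton (P := P) hS hC.1 (M k) (x k) (xh k)
  obtain ⟨q, hq, hxk⟩ := hrun.relaxedProjection k
  rw [hpr, Set.mem_singleton_iff] at hq
  subst hq
  refine ⟨q, hp, fun z hz => ?_⟩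
  rw [hxk]
  exact hS.pnorm_relaxed_sub_sq_le (hθ k).1.le
    (hvar z (hA.mem_halfspace hP hC (hrun.forwardBackward k) hz))

theorem IsRun.isFejerMonotone (hP : IsPosDef P) (hS : IsPosDef S) (hA : IsMonotone A)
    (hC : IsInvCocoercive β P C) (hθ : ∀ k, θ k ∈ Set.Ioo (0 : ℝ) 2) {x xh : ℕ → H}
    (hrun : IsRun A C β P S M θ x xh) : IsFejerMonotone S (zer (A + single C)) x := by
  intro z hz k
  obtain ⟨p, -, h⟩ := hrun.exists_sq_le hP hS hA hC hθ k
  refine le_of_sq_le_sq ((h z hz).trans (sub_le_self _ ?_)) (Real.sqrt_nonneg _)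
  exact mul_nonneg (mul_nonneg (hθ k).1.le (by linarith [(hθ k).2])) (sq_nonneg _)

theorem IsFejerMonotone.exists_tendsto {E : Type*} [NormedAddCommGroup E] [InnerProductSpace ℝ E]
    {S : E →L[ℝ] E} {Z : Set E} {x : ℕ → E} (h : IsFejerMonotone S Z x) {z : E} (hz : z ∈ Z) :
    ∃ d : ℝ, Tendsto (fun k => pnorm S (x k - z)) atTop (𝓝 d) :=
  ⟨_, tendsto_atTop_ciInf (antitone_nat_of_succ_le (h z hz))
    ⟨0, by rintro _ ⟨k, rfl⟩; exact Real.sqrt_nonneg _⟩⟩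

theorem IsFejerMonotone.exists_norm_le (hS : IsPosDef S) {Z : Set H} {x : ℕ → H}
    (h : IsFejerMonotone S Z x) (hZ : Z.Nonempty) : ∃ R, ∀ k, ‖x k‖ ≤ R := by
  obtain ⟨z, hz⟩ := hZ
  obtain ⟨lam, hlam, hlow⟩ := hS.lower
  refine ⟨pnorm S (x 0 - z) / Real.sqrt lam + ‖z‖, fun k => ?_⟩
  have h1 : pnorm S (x k - z) ≤ pnorm S (x 0 - z) :=
    antitone_nat_of_succ_le (f := fun k => pnorm S (x k - z)) (h z hz) k.zero_le
  have h2 : ‖x k - z‖ ≤ pnorm S (x 0 - z) / Real.sqrt lam := by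
    rw [le_div_iff₀ (Real.sqrt_pos.2 hlam)]
    refine (le_of_sq_le_sq ?_ (Real.sqrt_nonneg _) : _ ≤ pnorm S (x k - z)).trans h1
    rw [hS.pnorm_sq, mul_pow, Real.sq_sqrt hlam.le, mul_comm]
    exact hlow _
  calc ‖x k‖ = ‖(x k - z) + z‖ := by rw [sub_add_cancel]
    _ ≤ _ := (norm_add_le _ _).trans (by gcongr)

/-- The residuals vanish, since the squared distances to a zero of `A + C` decrease, up to a factor
bounded away from `0`, by at least the squared distances from `x k` to the halfspaces. -/
theorem IsRun.tendsto_sub_zero (hP : IsPosDef P) (hS : IsPosDef S) (hA : IsMonotone A)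
    (hβ : β < 4) (hC : IsInvCocoercive β P C) (hzer : (zer (A + single C)).Nonempty)
    (hM : ∀ k, IsStronglyMonotone 1 P (single (M k))) (hL : ∀ k, LipschitzWith L (M k))
    (hθ : ∀ k, θ k ∈ Set.Ioo (0 : ℝ) 2) (hlim : 0 < liminf (fun k => θ k * (2 - θ k)) atTop)
    {x xh : ℕ → H} (hrun : IsRun A C β P S M θ x xh) :
    Tendsto (fun k => x k - xh k) atTop (𝓝 0) := by
  obtain ⟨z, hz⟩ := hzer
  choose p hp hdec using hrun.exists_sq_le hP hS hA hC hθ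
  obtain ⟨d, hd⟩ := (hrun.isFejerMonotone hP hS hA hC hθ).exists_tendsto hz
  obtain ⟨ε, hε, hεlim⟩ := exists_between hlim
  have hθ0 : ∀ k, 0 ≤ θ k * (2 - θ k) := fun k =>
    mul_nonneg (hθ k).1.le (by linarith [(hθ k).2])
  have hev : ∀ᶠ k in atTop, ε < θ k * (2 - θ k) :=
    eventually_lt_of_lt_liminf hεlim (isBoundedUnder_of ⟨0, hθ0⟩)
  obtain ⟨lam, hlam, hlow⟩ := hP.lower
  obtain ⟨mu, hmu, hmulow⟩ := hS.lower
  set c := (1 - β / 4) * lam with hc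
  have hc0 : 0 < c := mul_pos (by linarith) hlam
  have hdiff : Tendsto (fun k => L ^ 2 / (c ^ 2 * mu * ε) *
      (pnorm S (x k - z) ^ 2 - pnorm S (x (k + 1) - z) ^ 2)) atTop (𝓝 0) := by
    have h1 := (hd.pow 2).sub (((tendsto_add_atTop_iff_nat 1).2 hd).pow 2)
    rw [sub_self] at h1
    simpa using h1.const_mul ((L : ℝ) ^ 2 / (c ^ 2 * mu * ε))
  have hsq : Tendsto (fun k => ‖x k - xh k‖ ^ 2) atTop (𝓝 0) := by
    refine squeeze_zero' (Eventually.of_forall fun k => sq_nonneg _) ?_ hdiff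
    filter_upwards [hev] with k hk
    have h1 := mul_norm_sub_le_of_mem_halfspace hP hlow hβ (hM k) (hL k) (hp k)
    have h2 := pow_le_pow_left₀ (by positivity) h1 2
    have h3 := hdec k z hz
    have h4 := hmulow (x k - p k)
    rw [← hS.pnorm_sq] at h4
    have h5 : ε * pnorm S (x k - p k) ^ 2 ≤ θ k * (2 - θ k) * pnorm S (x k - p k) ^ 2 :=
      mul_le_mul_of_nonneg_right hk.le (sq_nonneg _)
    rw [div_mul_eq_mul_div, le_div_iff₀ (by positivity)]
    calc ‖x k - xh k‖ ^ 2 * (c ^ 2 * mu * ε) = (c * ‖x k - xh k‖) ^ 2 * mu * ε := by ring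
      _ ≤ (L * ‖x k - p k‖) ^ 2 * mu * ε := by gcongr
      _ = L ^ 2 * (ε * (mu * ‖x k - p k‖ ^ 2)) := by ring
      _ ≤ L ^ 2 * (ε * pnorm S (x k - p k) ^ 2) := by gcongr
      _ ≤ L ^ 2 * (pnorm S (x k - z) ^ 2 - pnorm S (x (k + 1) - z) ^ 2) := by
        gcongr; linarith
  rw [tendsto_zero_iff_norm_tendsto_zero]
  simpa [Real.sqrt_sq] using hsq.sqrt

theorem IsRun.exists_tendsto_toWeakSpace (hP : IsPosDef P) (hS : IsPosDef S)
    (hA : IsMaximallyMonotone A) (hβ : β < 4) (hC : IsInvCocoercive β P C)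
    (hzer : (zer (A + single C)).Nonempty)
    (hM : ∀ k, IsStronglyMonotone 1 P (single (M k))) (hL : ∀ k, LipschitzWith L (M k))
    (hθ : ∀ k, θ k ∈ Set.Ioo (0 : ℝ) 2) (hlim : 0 < liminf (fun k => θ k * (2 - θ k)) atTop)
    {x xh : ℕ → H} (hrun : IsRun A C β P S M θ x xh) :
    ∃ a ∈ zer (A + single C),
      Tendsto (fun k => toWeakSpace ℝ H (x k)) atTop (𝓝 (toWeakSpace ℝ H a)) := by
  have hfej := hrun.isFejerMonotone hP hS hA.1 hC hθ
  have hres := hrun.tendsto_sub_zero hP hS hA.1 hβ hC hzer hM hL hθ hlim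
  obtain ⟨R, hR⟩ := hfej.exists_norm_le hS hzer
  obtain ⟨K, hK⟩ := hC.exists_lipschitz hP
  obtain ⟨R', hR'⟩ := hres.norm.bddAbove_range
  have hxhR : ∀ k, ‖xh k‖ ≤ R + R' := fun k => by
    calc ‖xh k‖ = ‖x k - (x k - xh k)‖ := by rw [sub_sub_cancel]
      _ ≤ _ := (norm_sub_le _ _).trans (add_le_add (hR k) (hR' ⟨k, rfl⟩))
  have hu : Tendsto (fun k => M k (x k) - C (x k) - M k (xh k) + C (xh k)) atTop (𝓝 0) := by
    refine squeeze_zero_norm (a := fun k => (L + K) * ‖x k - xh k‖) (fun k => ?_)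
      (by simpa using hres.norm.const_mul ((L : ℝ) + K))
    have h1 : M k (x k) - C (x k) - M k (xh k) + C (xh k)
        = (M k (x k) - M k (xh k)) - (C (x k) - C (xh k)) := by abel
    rw [h1, add_mul]
    exact (norm_sub_le _ _).trans (add_le_add
      (by simpa [dist_eq_norm] using (hL k).dist_le_mul (x k) (xh k)) (hK _ _))
  obtain ⟨a, ha, hlim⟩ := hS.exists_tendsto_inner_of_tendsto_pnorm hR
    (fun z hz => hfej.exists_tendsto hz) fun U a hU ha => by
      refine hA.mem_zer_of_tendsto (l := U) hP hC hxhR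
        (fun k => mem_fbMap_iff.1 (hrun.forwardBackward k)) (hu.mono_left hU) fun h => ?_
      have h1 : Tendsto (fun k => inner ℝ (x k - xh k) h) U (𝓝 0) := by
        simpa using ((hres.mono_left hU).inner (𝕜 := ℝ) tendsto_const_nhds : Tendsto
          (fun k => inner ℝ (x k - xh k) h) U _)
      have h2 := (ha h).sub h1
      simpa [inner_sub_left] using h2
  exact ⟨a, ha, tendsto_toWeakSpace_iff.2 hlim⟩

end

end NOFOB

theorem theorem5p2 {H : Type*} [NormedAddCommGroup H] [InnerProductSpace ℝ H] [CompleteSpace H]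
    (A : H → Set H) (C : H → H) (β : ℝ) (P S : H →L[ℝ] H) (M : ℕ → H → H) (L : NNReal)
    (θ : ℕ → ℝ)
    (hP : NOFOB.IsPosDef P) (hS : NOFOB.IsPosDef S)
    (hA : NOFOB.IsMaximallyMonotone A)
    (hβ : β ∈ Set.Ico (0 : ℝ) 4) (hC : NOFOB.IsInvCocoercive β P C)
    (hzer : (NOFOB.zer (A + NOFOB.single C)).Nonempty)
    (hM : ∀ k, NOFOB.IsStronglyMonotone 1 P (NOFOB.single (M k)))
    (hL : ∀ k, LipschitzWith L (M k))
    (hθ : ∀ k, θ k ∈ Set.Ioo (0 : ℝ) 2)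
    (hlim : 0 < liminf (fun k => θ k * (2 - θ k)) atTop) :
    -- from every starting point the algorithm constructs exactly one pair of infinite sequences
    (∀ x₀ : H, ∃! r : (ℕ → H) × (ℕ → H),
      r.1 0 = x₀ ∧ NOFOB.IsRun A C β P S M θ r.1 r.2) ∧
    -- and these have the following properties
    (∀ x xh : ℕ → H, NOFOB.IsRun A C β P S M θ x xh →
      NOFOB.IsFejerMonotone S (NOFOB.zer (A + NOFOB.single C)) x ∧
      (∀ z ∈ NOFOB.zer (A + NOFOB.single C),
        ∃ d : ℝ, Tendsto (fun k => NOFOB.pnorm S (x k - z)) atTop (𝓝 d)) ∧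
      Tendsto (fun k => NOFOB.pnorm S (x k - xh k)) atTop (𝓝 0) ∧
      ∃ xbar ∈ NOFOB.zer (A + NOFOB.single C),
        Tendsto (fun k => toWeakSpace ℝ H (x k)) atTop (𝓝 (toWeakSpace ℝ H xbar))) := by
  refine ⟨NOFOB.existsUnique_isRun hP hS hA hβ.1 hM hL, fun x xh hrun => ?_⟩
  have hfej := hrun.isFejerMonotone hP hS hA.1 hC hθ
  refine ⟨hfej, fun z hz => hfej.exists_tendsto hz, ?_,
    hrun.exists_tendsto_toWeakSpace hP hS hA hβ.2 hC hzer hM hL hθ hlim⟩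
  have h := (NOFOB.continuous_pnorm S).tendsto 0 |>.comp
    (hrun.tendsto_sub_zero hP hS hA.1 hβ.2 hC hzer hM hL hθ hlim)
  rwa [show NOFOB.pnorm S 0 = 0 by simp [NOFOB.pnorm]] at h
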